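/- For integers $B\ge 1$ and $n\ge 0$, a PCSA summary of $n$ distinct items with $B$ buckets and infinitely many levels is the random bit matrix $S\in\{0,1\}^{\{1,\dots,B\}\times\{1,2,3,\dots\}}$ obtained as follows. The items $x=1,\dots,n$ get i.i.d. hash values $(h_1(x),h_2(x))$, where $h_1(x)$ is uniform on $\{1,\dots,B\}$, $h_2(x)$ is independent of $h_1(x)$, and $\Pr(h_2(x)=j)=2^{-j}$ for $j\ge 1$; and $S_{ij}=1$ if and only if $(h_1(x),h_2(x))=(i,j)$ for some item $x$. A Poissonized summary $\overline S$ (with parameters $B,n$) is a PCSA summary of $N$ distinct items, where $N\sim\mathrm{Poisson}(n)$ is independent of the hash values. An independent-entry summary $\tilde S$ (with parameters $B,n$) is a random bit matrix whose true likelihood is the composite marginal likelihood, i.e. its entries are independent and each entry $\tilde S_{ij}$ has the same law as the corresponding entry of a PCSA summary of $n$ distinct items, namely $\mathrm{Bernoulli}\bigl(1-(1-2^{-j}/B)^n\bigr)$. Let $B(n)\ge 1$ be integers with $B(n)\log B(n)=o(\sqrt n)$ as $n\to\infty$, and for each $n$ let $S_n$ be a PCSA summary of $n$ distinct items with $B(n)$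 buckets and infinitely many levels, all of them defined on one probability space (with arbitrary dependence between different $n$). Then, after possibly enlarging the probability space (that is, on a probability space with a measure-preserving map to the given one, along which the $S_n$ are pulled back), there exist, for every $n$, a Poissonized summary $\overline S_n$ and an independent-entry summary $\tilde S_n$, both with parameters $B(n),n$, such that $$\Pr\bigl(S_n=\tilde S_n=\overline S_n\bigr)\longrightarrow 1\qquad\text{as } n\to\infty .$$ -/

import Mathlib

open MeasureTheory ProbabilityTheory Filter Topology Asymptotics

universe u

/-- The location of a bit: a bucket `i : Fin B` and a level. Levels are numbered from `0` here, so
that `(i, k)` is level `k + 1` in the usual numbering `1, 2, 3, …` of the geometric levels. -/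
abbrev Cell (B : ℕ) : Type := Fin B × ℕ

/-- A bit matrix with `B` buckets and infinitely many levels, with the product `σ`-algebra. -/
abbrev Sketch (B : ℕ) : Type := Cell B → Bool

/-- The PCSA summary of items with hash values `h`: a bit is `1` iff some item hashes to it. -/
noncomputable def pcsa {B n : ℕ} (h : Fin n → Cell B) : Sketch B :=
  open Classical in fun c => decide (∃ x, h x = c)

/-- The law of the hash value of one item: the bucket is uniform, and independently the level is
geometric with parameter `1 / 2`, i.e. `(i, k)` has probability `2⁻¹ ^ (k + 1) / B`. -/
noncomputable def hashLaw (B : ℕ) : Measure (Cell B) :=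
  (uniformOn (Set.univ : Set (Fin B))).prod
    (geometricMeasure ⟨(2 : ℝ)⁻¹, by norm_num, by norm_num⟩)

/-- The law of the PCSA summary of `n` distinct items, whose hash values are i.i.d. -/
noncomputable def pcsaLaw (B n : ℕ) : Measure (Sketch B) :=
  (Measure.pi fun _ : Fin n => hashLaw B).map pcsa

/-- The law of the PCSA summary of `N` distinct items, where `N ∼ Poisson(n)` is independent of
the hash values. -/
noncomputable def poissonPcsaLaw (B n : ℕ) : Measure (Sketch B) :=
  (poissonMeasure (n : NNReal)).bind (pcsaLaw B)

/-- The law whose likelihood is the composite marginal likelihood for `n` items, i.e. the product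
of the marginal likelihoods of the bits of a PCSA summary: the bits are independent, and each one
has the same law as the corresponding bit of the PCSA summary of `n` distinct items
(see `map_eval_pcsaLaw` for this law in closed form). -/
noncomputable def compositeLaw (B n : ℕ) : Measure (Sketch B) :=
  Measure.infinitePi fun c : Cell B => (pcsaLaw B n).map (fun s => s c)

theorem measurable_pcsa {B n : ℕ} : Measurable (pcsa : (Fin n → Cell B) → Sketch B) :=
  measurable_of_countable _

instance isProbabilityMeasure_hashLaw (B : ℕ) [NeZero B] : IsProbabilityMeasure (hashLaw B) := by
  have := isProbabilityMeasure_uniformOn (Set.finite_univ (α := Fin B)) Set.univ_nonempty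
  unfold hashLaw
  infer_instance

instance isProbabilityMeasure_pcsaLaw (B n : ℕ) [NeZero B] :
    IsProbabilityMeasure (pcsaLaw B n) :=
  Measure.isProbabilityMeasure_map measurable_pcsa.aemeasurable

instance isProbabilityMeasure_poissonPcsaLaw (B n : ℕ) [NeZero B] :
    IsProbabilityMeasure (poissonPcsaLaw B n) :=
  isProbabilityMeasure_bind (measurable_of_countable _).aemeasurable
    (Eventually.of_forall fun _ => inferInstance)

instance isProbabilityMeasure_map_eval_pcsaLaw (B n : ℕ) [NeZero B] (c : Cell B) :
    IsProbabilityMeasure ((pcsaLaw B n).map (fun s => s c)) :=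
  Measure.isProbabilityMeasure_map (measurable_pi_apply c).aemeasurable

instance isProbabilityMeasure_compositeLaw (B n : ℕ) [NeZero B] :
    IsProbabilityMeasure (compositeLaw B n) := by
  unfold compositeLaw
  infer_instance

/-- The probability `ρ` that an item is mapped to a given cell. -/
noncomputable def cellProb {B : ℕ} (c : Cell B) : ℝ := (2 : ℝ)⁻¹ ^ (c.2 + 1) / B

theorem cellProb_mem {B : ℕ} (c : Cell B) : cellProb c ∈ unitInterval := by
  unfold cellProb
  have hB : (1 : ℝ) ≤ B := by exact_mod_cast c.1.pos
  refine ⟨by positivity, ?_⟩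
  rw [div_le_one (by positivity)]
  exact (pow_le_one₀ (by norm_num) (by norm_num)).trans hB

theorem hashLaw_real_singleton {B : ℕ} (c : Cell B) :
    (hashLaw B).real {c} = cellProb c := by
  obtain ⟨i, k⟩ := c
  have hg := geometricMeasure_real_singleton
    (p := ⟨(2 : ℝ)⁻¹, by norm_num, by norm_num⟩) (by simp [← unitInterval.coe_ne_zero]) k
  have hu : (uniformOn (Set.univ : Set (Fin B))).real {i} = (B : ℝ)⁻¹ := by
    simp [measureReal_def, uniformOn_univ]
  rw [hashLaw, ← Set.singleton_prod_singleton, measureReal_prod_prod, hg, hu, cellProb]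
  norm_num [pow_succ]
  ring

/-- The bit in cell `c` is `Bernoulli (1 - γ ^ n)` with `γ = 1 - ρ`. -/
theorem map_eval_pcsaLaw (B n : ℕ) (c : Cell B) :
    (pcsaLaw B n).map (fun s => s c) = bernoulliMeasure true false
      ⟨1 - (1 - cellProb c) ^ n, by
        have h := cellProb_mem c
        have h0 : 0 ≤ 1 - cellProb c := by linarith [h.2]
        have h1 : 1 - cellProb c ≤ 1 := by linarith [h.1]
        exact ⟨by linarith [pow_le_one₀ (n := n) h0 h1], by linarith [pow_nonneg h0 n]⟩⟩ := by
  have : NeZero B := ⟨c.1.pos.ne'⟩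
  have hf : ((pcsaLaw B n).map (fun s => s c)).real {false} = (1 - cellProb c) ^ n := by
    have hset : (fun s : Sketch B => s c) ∘ pcsa ⁻¹' {false}
        = Set.univ.pi (fun _ : Fin n => ({c}ᶜ : Set (Cell B))) := by
      ext h
      simp [pcsa]
    rw [pcsaLaw, Measure.map_map (measurable_pi_apply c) measurable_pcsa,
      map_measureReal_apply ((measurable_pi_apply c).comp measurable_pcsa) (by simp), hset,
      measureReal_def, Measure.pi_pi, ENNReal.toReal_prod]
    simp only [← measureReal_def, probReal_compl_eq_one_sub (measurableSet_singleton c),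
      hashLaw_real_singleton]
    simp
  have ht : ((pcsaLaw B n).map (fun s => s c)).real {true} = 1 - (1 - cellProb c) ^ n := by
    rw [← hf, ← probReal_compl_eq_one_sub (by simp)]
    congr 1
    ext b
    simp
  refine Measure.ext_of_measureReal_singleton fun b => ?_
  have hm : MeasurableSet {b} := measurableSet_singleton b
  cases b
  · rw [hf, bernoulliMeasure_real_apply _ hm]
    simp
  · rw [ht, bernoulliMeasure_real_apply _ hm]
    simp

/-!
Keep a sample point of `μ` with probability the density of `μ ⊓ ν` relative to `μ` at that point,
and resample it otherwise: this produces a sample of `ν` that differs from the given one with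
probability at most the total variation distance of `μ` and `ν`. As the resampling uses fresh
randomness, the given sequence of sketches is retained, and it suffices that the laws get close in
total variation.

The three laws are compared on the cells of level at least `j` and on the cells below `j`
separately. With `x = n * 2⁻ʲ / B`, a cell `i + 1` levels below `j` is hit on average `x * 2 ^ i`
times, so each law has some bit `0` below level `j` with probability at most `2 * B * exp (-x)`.
From level `j` on, each of the three laws is the bitwise disjunction of `n` independent copies of a
one-item law. An item reaches these levels with probability `q = 2⁻ʲ`, and the bits it sets, at most
one, are at distance at most `q ^ 2` from independent bits; the `n` items together contribute at
most `n * 4⁻ʲ`. Put `y = B * (1 + log B)` and `r ^ 2 = √n / y`, and let `2 ^ j` lie between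
`n / (2 * y * r)` and `n / (y * r)`; then both errors are `O(y / √n)`.
-/

open scoped ENNReal unitInterval

section TotalVariation

variable {X Y : Type*} [MeasurableSpace X] [MeasurableSpace Y]

/-- The largest excess of `μ` over `ν` on a measurable set. For probability measures this is the
total variation distance; the one-sided form avoids subtractions of real numbers. -/
noncomputable def tvDist (μ ν : Measure X) : ℝ≥0∞ :=
  ⨆ (A : Set X) (_ : MeasurableSet A), μ A - ν A

theorem tvDist_le_iff {μ ν : Measure X} {ε : ℝ≥0∞} :
    tvDist μ ν ≤ ε ↔ ∀ A, MeasurableSet A → μ A ≤ ν A + ε := by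
  simp only [tvDist, iSup_le_iff, tsub_le_iff_left]

theorem measure_le_add_tvDist (μ ν : Measure X) {A : Set X} (hA : MeasurableSet A) :
    μ A ≤ ν A + tvDist μ ν :=
  tvDist_le_iff.1 le_rfl A hA

theorem tvDist_map_le (μ ν : Measure X) {f : X → Y} (hf : Measurable f) :
    tvDist (μ.map f) (ν.map f) ≤ tvDist μ ν := by
  refine tvDist_le_iff.2 fun A hA => ?_
  rw [Measure.map_apply hf hA, Measure.map_apply hf hA]
  exact measure_le_add_tvDist μ ν (hf hA)

theorem tvDist_prod_le (μ ν : Measure X) (μ' ν' : Measure Y) [IsProbabilityMeasure μ]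
    [SFinite ν] [SFinite μ'] [IsProbabilityMeasure ν'] :
    tvDist (μ.prod μ') (ν.prod ν') ≤ tvDist μ ν + tvDist μ' ν' := by
  refine tvDist_le_iff.2 fun A hA => ?_
  calc μ.prod μ' A = ∫⁻ x, μ' (Prod.mk x ⁻¹' A) ∂μ := Measure.prod_apply hA
    _ ≤ ∫⁻ x, (ν' (Prod.mk x ⁻¹' A) + tvDist μ' ν') ∂μ :=
        lintegral_mono fun x => measure_le_add_tvDist _ _ (measurable_prodMk_left hA)
    _ = μ.prod ν' A + tvDist μ' ν' := by
        rw [lintegral_add_right _ measurable_const, ← Measure.prod_apply hA, lintegral_const,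
          measure_univ, mul_one]
    _ = ∫⁻ y, μ ((·, y) ⁻¹' A) ∂ν' + tvDist μ' ν' := by rw [Measure.prod_apply_symm hA]
    _ ≤ ∫⁻ y, (ν ((·, y) ⁻¹' A) + tvDist μ ν) ∂ν' + tvDist μ' ν' := by
        gcongr with y
        exact measure_le_add_tvDist _ _ (measurable_prodMk_right hA)
    _ = ν.prod ν' A + (tvDist μ ν + tvDist μ' ν') := by
        rw [lintegral_add_right _ measurable_const, ← Measure.prod_apply_symm hA, lintegral_const,
          measure_univ, mul_one, add_assoc]

theorem tvDist_pi_le {n : ℕ} {Z : Fin n → Type*} [∀ i, MeasurableSpace (Z i)]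
    (μ ν : ∀ i, Measure (Z i)) [∀ i, IsProbabilityMeasure (μ i)]
    [∀ i, IsProbabilityMeasure (ν i)] :
    tvDist (Measure.pi μ) (Measure.pi ν) ≤ ∑ i, tvDist (μ i) (ν i) := by
  induction n with
  | zero =>
    refine tvDist_le_iff.2 fun A _ => ?_
    rw [Measure.pi_of_empty, Measure.pi_of_empty]
    exact le_self_add
  | succ n ih =>
    rw [← (measurePreserving_piFinSuccAbove μ 0).symm.map_eq,
      ← (measurePreserving_piFinSuccAbove ν 0).symm.map_eq, Fin.sum_univ_succ]
    exact (tvDist_map_le _ _ (MeasurableEquiv.measurable _)).trans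
      ((tvDist_prod_le _ _ _ _).trans (add_le_add le_rfl (ih _ _)))

theorem one_sub_inf_univ_le_tvDist (μ ν : Measure X) [IsProbabilityMeasure μ] :
    1 - (μ ⊓ ν) Set.univ ≤ tvDist μ ν := by
  rw [tsub_le_iff_left, ← tsub_le_iff_right, Measure.inf_apply MeasurableSet.univ]
  refine le_sInf ?_
  rintro _ ⟨t, rfl⟩
  have hm := measurableSet_toMeasurable μ t
  rw [tsub_le_iff_right, Set.inter_univ, Set.inter_univ]
  calc (1 : ℝ≥0∞) = μ t + μ (toMeasurable μ t)ᶜ := by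
        rw [← measure_toMeasurable t, measure_add_measure_compl hm, measure_univ]
    _ ≤ μ t + (ν (toMeasurable μ t)ᶜ + tvDist μ ν) := by
        gcongr
        exact measure_le_add_tvDist _ _ hm.compl
    _ ≤ μ t + ν tᶜ + tvDist μ ν := by
        rw [← add_assoc]
        gcongr
        exact subset_toMeasurable μ t

theorem tvDist_le_tvDist_map_add (μ ν : Measure X) {f : X → Y} {k : Y → X} (hf : Measurable f)
    (hk : Measurable k) :
    tvDist μ ν ≤ tvDist (μ.map f) (ν.map f) + μ {x | k (f x) ≠ x} + ν {x | k (f x) ≠ x} := by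
  refine tvDist_le_iff.2 fun A hA => ?_
  have key := measure_le_add_tvDist (μ.map f) (ν.map f) (hk hA)
  rw [Measure.map_apply hf (hk hA), Measure.map_apply hf (hk hA)] at key
  have hsub : A ⊆ f ⁻¹' (k ⁻¹' A) ∪ {x | k (f x) ≠ x} := fun x hx => by
    by_cases h : k (f x) = x
    · exact .inl (h.symm ▸ hx : k (f x) ∈ A)
    · exact .inr h
  have hsub' : f ⁻¹' (k ⁻¹' A) ⊆ A ∪ {x | k (f x) ≠ x} := fun x hx => by
    by_cases h : k (f x) = x
    · exact .inl (h ▸ hx)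
    · exact .inr h
  calc μ A ≤ μ (f ⁻¹' (k ⁻¹' A)) + μ {x | k (f x) ≠ x} :=
        (measure_mono hsub).trans (measure_union_le _ _)
    _ ≤ (ν A + ν {x | k (f x) ≠ x} + tvDist (μ.map f) (ν.map f)) + μ {x | k (f x) ≠ x} := by
        gcongr
        exact key.trans (by gcongr; exact (measure_mono hsub').trans (measure_union_le _ _))
    _ = ν A + (tvDist (μ.map f) (ν.map f) + μ {x | k (f x) ≠ x} + ν {x | k (f x) ≠ x}) := by ring

theorem tvDist_map_le_of_singleton_le [Countable Y] [MeasurableSingletonClass X]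
    {q : Measure Y} {ν κ : Measure X} {f : Y → X} (hf : Measurable f)
    (h : ∀ y, q.map f {f y} ≤ ν {f y} + κ {f y}) : tvDist (q.map f) ν ≤ κ Set.univ := by
  refine tvDist_le_iff.2 fun A hA => ?_
  have hcount : (A ∩ Set.range f).Countable := (Set.countable_range f).mono Set.inter_subset_right
  have hsum (ξ : Measure X) : ξ (A ∩ Set.range f) = ∑' x : ↥(A ∩ Set.range f), ξ {x.1} := by
    simpa using (tsum_measure_preimage_singleton (μ := ξ) (f := id) hcount
      fun x _ => measurableSet_singleton x).symm
  calc q.map f A = q.map f (A ∩ Set.range f) := by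
        rw [Measure.map_apply hf hA, Measure.map_apply hf hcount.measurableSet,
          Set.preimage_inter_range]
    _ ≤ ∑' x : ↥(A ∩ Set.range f), (ν {x.1} + κ {x.1}) := by
        rw [hsum]
        refine ENNReal.tsum_le_tsum fun ⟨x, _, y, hy⟩ => ?_
        exact hy ▸ h y
    _ = ν (A ∩ Set.range f) + κ (A ∩ Set.range f) := by rw [ENNReal.tsum_add, ← hsum, ← hsum]
    _ ≤ ν A + κ Set.univ := by
        gcongr
        · exact Set.inter_subset_left
        · exact Set.subset_univ _

end TotalVariation

section Coupling

universe v w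

variable {X : Type*} [MeasurableSpace X]

/-- Keep the point `x` if `u ≤ f x` and replace it by `y` otherwise: for uniform `u`, the point is
kept with probability `f x`. -/
noncomputable def keepOrReplace (f : X → I) (z : X × (I × X)) : X :=
  if z.2.1 ≤ f z.1 then z.1 else z.2.2

theorem measurable_keepOrReplace {f : X → I} (hf : Measurable f) :
    Measurable (keepOrReplace f) :=
  Measurable.ite (measurableSet_le (by fun_prop) (by fun_prop)) (by fun_prop) (by fun_prop)

theorem map_keepOrReplace (μ res : Measure X) [IsProbabilityMeasure res] {f : X → I}
    (hf : Measurable f) :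
    (μ.prod (volume.prod res)).map (keepOrReplace f) =
      μ.withDensity (fun x => ENNReal.ofReal (f x)) +
        (∫⁻ x, ENNReal.ofReal (1 - f x) ∂μ) • res := by
  ext A hA
  have hslice (x : X) : (volume.prod res) (Prod.mk x ⁻¹' (keepOrReplace f ⁻¹' A)) =
      A.indicator (fun x => ENNReal.ofReal (f x)) x + ENNReal.ofReal (1 - f x) * res A := by
    have hsplit : Prod.mk x ⁻¹' (keepOrReplace f ⁻¹' A) =
        (Set.Iic (f x) ×ˢ {_y : X | x ∈ A}) ∪ (Set.Ioi (f x) ×ˢ A) := by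
      ext ⟨u, y⟩
      by_cases hu : u ≤ f x
      · simp [keepOrReplace, hu]
      · simp [keepOrReplace, hu, not_le.1 hu]
    have hdisj : Disjoint (Set.Iic (f x) ×ˢ {_y : X | x ∈ A}) (Set.Ioi (f x) ×ˢ A) :=
      Set.Disjoint.set_prod_left (Set.Iic_disjoint_Ioi le_rfl) _ _
    rw [hsplit, measure_union hdisj (measurableSet_Ioi.prod hA), Measure.prod_prod,
      Measure.prod_prod, unitInterval.volume_Iic, unitInterval.volume_Ioi]
    by_cases hx : x ∈ A <;> simp [hx]
  have hfm : Measurable fun x => ENNReal.ofReal (f x) := by fun_prop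
  have hkeep := measurable_keepOrReplace hf hA
  rw [Measure.map_apply (measurable_keepOrReplace hf) hA, Measure.prod_apply hkeep]
  simp_rw [hslice]
  rw [lintegral_add_left (hfm.indicator hA), lintegral_indicator hA,
    lintegral_mul_const _ (by fun_prop), Measure.add_apply, withDensity_apply _ hA,
    Measure.smul_apply, smul_eq_mul]

theorem measure_keepOrReplace_ne_le (μ res : Measure X) [IsProbabilityMeasure res]
    {f : X → I} (hf : Measurable f) :
    (μ.prod (volume.prod res)) {z | keepOrReplace f z ≠ z.1} ≤
      ∫⁻ x, ENNReal.ofReal (1 - f x) ∂μ := by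
  have hlt : MeasurableSet {z : X × (I × X) | f z.1 < z.2.1} :=
    measurableSet_lt (by fun_prop) (by fun_prop)
  have hslice (x : X) : Prod.mk x ⁻¹' {z : X × (I × X) | f z.1 < z.2.1} =
      Set.Ioi (f x) ×ˢ Set.univ := by
    ext z
    simp
  calc (μ.prod (volume.prod res)) {z | keepOrReplace f z ≠ z.1}
      ≤ (μ.prod (volume.prod res)) {z | f z.1 < z.2.1} :=
        measure_mono fun z hz => not_le.1 fun hle => hz (if_pos hle)
    _ = ∫⁻ x, ENNReal.ofReal (1 - f x) ∂μ := by
        rw [Measure.prod_apply hlt]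
        simp_rw [hslice, Measure.prod_prod, measure_univ, mul_one, unitInterval.volume_Ioi]

theorem exists_withDensity_ofReal_eq {μ m : Measure X} [IsFiniteMeasure μ] (h : m ≤ μ) :
    ∃ f : X → I, Measurable f ∧ μ.withDensity (fun x => ENNReal.ofReal (f x)) = m := by
  have : IsFiniteMeasure m := isFiniteMeasure_of_le μ h
  refine ⟨fun x => Set.projIcc 0 1 zero_le_one (m.rnDeriv μ x).toReal,
    continuous_projIcc.measurable.comp (Measure.measurable_rnDeriv m μ).ennreal_toReal, ?_⟩
  rw [withDensity_congr_ae (g := m.rnDeriv μ),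
    Measure.withDensity_rnDeriv_eq _ _ h.absolutelyContinuous]
  filter_upwards [Measure.rnDeriv_le_one_of_le h] with x hx
  have hx1 : (m.rnDeriv μ x).toReal ≤ 1 := ENNReal.toReal_le_of_le_ofReal zero_le_one (by simpa)
  rw [Set.projIcc_of_mem zero_le_one ⟨ENNReal.toReal_nonneg, hx1⟩,
    ENNReal.ofReal_toReal (ne_top_of_le_ne_top ENNReal.one_ne_top hx)]

theorem exists_isProbabilityMeasure_smul_eq [Nonempty X] (ρ : Measure X) [IsFiniteMeasure ρ] :
    ∃ res : Measure X, IsProbabilityMeasure res ∧ ρ Set.univ • res = ρ := by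
  obtain rfl | hρ := eq_zero_or_neZero ρ
  · exact ⟨Measure.dirac (Classical.arbitrary X), inferInstance, by simp⟩
  · refine ⟨(ρ Set.univ)⁻¹ • ρ, inferInstance, ?_⟩
    rw [smul_smul, ENNReal.mul_inv_cancel (NeZero.ne _) (measure_ne_top _ _), one_smul]

theorem exists_map_prod_eq (μ ν : Measure X) [IsProbabilityMeasure μ] [IsProbabilityMeasure ν] :
    ∃ (τ : Measure (I × X)) (_ : IsProbabilityMeasure τ) (g : X × (I × X) → X), Measurable g ∧
      (μ.prod τ).map g = ν ∧ (μ.prod τ) {z | g z ≠ z.1} ≤ tvDist μ ν := by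
  have : Nonempty X := μ.nonempty_of_neZero
  have : IsFiniteMeasure (μ ⊓ ν) := isFiniteMeasure_of_le μ inf_le_left
  obtain ⟨f, hf, hfm⟩ := exists_withDensity_ofReal_eq (inf_le_left : μ ⊓ ν ≤ μ)
  obtain ⟨res, hres, hres_eq⟩ := exists_isProbabilityMeasure_smul_eq (ν - μ ⊓ ν)
  have hmass : ∫⁻ x, ENNReal.ofReal (1 - f x) ∂μ = 1 - (μ ⊓ ν) Set.univ := by
    refine ENNReal.eq_sub_of_add_eq (measure_ne_top _ _) ?_
    rw [← hfm, withDensity_apply _ MeasurableSet.univ, Measure.restrict_univ,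
      ← lintegral_add_left (by fun_prop)]
    have hone (x : X) : ENNReal.ofReal (1 - f x) + ENNReal.ofReal (f x) = 1 := by
      rw [← ENNReal.ofReal_add (sub_nonneg.2 (f x).2.2) (f x).2.1, sub_add_cancel,
        ENNReal.ofReal_one]
    simp_rw [hone, lintegral_one, measure_univ]
  have hres_mass : (ν - μ ⊓ ν) Set.univ = 1 - (μ ⊓ ν) Set.univ := by
    rw [Measure.sub_apply MeasurableSet.univ inf_le_right, measure_univ]
  refine ⟨volume.prod res, inferInstance, keepOrReplace f, measurable_keepOrReplace hf, ?_, ?_⟩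
  · rw [map_keepOrReplace μ res hf, hfm, hmass, ← hres_mass, hres_eq, add_comm,
      Measure.sub_add_cancel_of_le inf_le_right]
  · exact (measure_keepOrReplace_ne_le μ res hf).trans
      (hmass.le.trans (one_sub_inf_univ_le_tvDist μ ν))

theorem exists_enlarged_coupling {ι : Type v} {X : ι → Type w} [∀ i, MeasurableSpace (X i)]
    {Ω : Type u} [MeasurableSpace Ω] (P : Measure Ω) [IsProbabilityMeasure P]
    (μ ν : ∀ i, Measure (X i)) [∀ i, IsProbabilityMeasure (μ i)] [∀ i, IsProbabilityMeasure (ν i)]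
    (S : ∀ i, Ω → X i) (hS : ∀ i, HasLaw (S i) (μ i) P) :
    ∃ (Ω' : Type (max u v w)) (_ : MeasurableSpace Ω') (P' : Measure Ω')
      (_ : IsProbabilityMeasure P') (π : Ω' → Ω) (T : ∀ i, Ω' → X i), MeasurePreserving π P' P ∧
      (∀ i, HasLaw (T i) (ν i) P') ∧
      ∀ i, P' {ω | S i (π ω) ≠ T i ω} ≤ tvDist (μ i) (ν i) := by
  choose τ hτ g hg hlaw hne using fun i => exists_map_prod_eq (μ i) (ν i)
  let P' := P.prod (Measure.infinitePi τ)
  have hpair (i : ι) : HasLaw (fun ω : Ω × (∀ i, I × X i) => (S i ω.1, ω.2 i))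
      ((μ i).prod (τ i)) P' :=
    IndepFun.hasLaw_prod ((hS i).comp measurePreserving_fst.hasLaw)
      ((measurePreserving_eval_infinitePi τ i).hasLaw.comp measurePreserving_snd.hasLaw)
      (indepFun_prod₀ (hS i).aemeasurable (measurable_pi_apply i).aemeasurable)
  refine ⟨Ω × (∀ i, I × X i), inferInstance, P', inferInstance, Prod.fst,
    fun i ω => g i (S i ω.1, ω.2 i), measurePreserving_fst,
    fun i => HasLaw.comp ⟨(hg i).aemeasurable, hlaw i⟩ (hpair i), fun i => ?_⟩
  calc P' {ω | S i ω.1 ≠ g i (S i ω.1, ω.2 i)}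
      ≤ P'.map (fun ω => (S i ω.1, ω.2 i)) {z | g i z ≠ z.1} :=
        (measure_mono fun ω hω => Ne.symm hω).trans (Measure.le_map_apply (hpair i).aemeasurable _)
    _ ≤ tvDist (μ i) (ν i) := by
        rw [(hpair i).map_eq]
        exact hne i

theorem exists_enlarged_coupling_pair {ι : Type v} {X : ι → Type w} [∀ i, MeasurableSpace (X i)]
    {Ω : Type u} [MeasurableSpace Ω] (P : Measure Ω) [IsProbabilityMeasure P]
    (μ ν κ : ∀ i, Measure (X i)) [∀ i, IsProbabilityMeasure (μ i)]
    [∀ i, IsProbabilityMeasure (ν i)] [∀ i, IsProbabilityMeasure (κ i)]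
    (S : ∀ i, Ω → X i) (hS : ∀ i, HasLaw (S i) (μ i) P) :
    ∃ (Ω' : Type (max u v w)) (_ : MeasurableSpace Ω') (P' : Measure Ω')
      (_ : IsProbabilityMeasure P') (π : Ω' → Ω) (T U : ∀ i, Ω' → X i), MeasurePreserving π P' P ∧
      (∀ i, HasLaw (T i) (ν i) P') ∧ (∀ i, HasLaw (U i) (κ i) P') ∧
      ∀ i, P' {ω | S i (π ω) = U i ω ∧ U i ω = T i ω}ᶜ ≤
        tvDist (μ i) (ν i) + tvDist (μ i) (κ i) := by
  obtain ⟨Ω₁, _, P₁, _, π₁, T, hπ₁, hT, hST⟩ := exists_enlarged_coupling P μ ν S hS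
  obtain ⟨Ω₂, _, P₂, _, π₂, U, hπ₂, hU, hSU⟩ := exists_enlarged_coupling P₁ μ κ
    (fun i => S i ∘ π₁) fun i => (hS i).comp hπ₁.hasLaw
  refine ⟨Ω₂, _, P₂, ‹_›, π₁ ∘ π₂, fun i => T i ∘ π₂, U, hπ₁.comp hπ₂,
    fun i => (hT i).comp hπ₂.hasLaw, hU, fun i => ?_⟩
  have hcover : {ω | S i ((π₁ ∘ π₂) ω) = U i ω ∧ U i ω = (T i ∘ π₂) ω}ᶜ ⊆
      π₂ ⁻¹' {ω | S i (π₁ ω) ≠ T i ω} ∪ {ω | (S i ∘ π₁) (π₂ ω) ≠ U i ω} := by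
    intro ω hω
    by_contra h
    obtain ⟨hT, hU⟩ : S i (π₁ (π₂ ω)) = T i (π₂ ω) ∧ S i (π₁ (π₂ ω)) = U i ω := by
      simpa [not_or] using h
    exact hω ⟨hU, hU.symm.trans hT⟩
  exact (measure_mono hcover).trans ((measure_union_le _ _).trans
    (add_le_add ((hπ₂.measure_preimage_le _).trans (hST i)) (hSU i)))

theorem tendsto_measure_one_of_compl {α Ω : Type*} {l : Filter α} [MeasurableSpace Ω]
    {P : Measure Ω} [IsProbabilityMeasure P] {E : α → Set Ω}
    (h : Tendsto (fun a => P (E a)ᶜ) l (𝓝 0)) : Tendsto (fun a => P (E a)) l (𝓝 1) := by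
  have hlim : Tendsto (fun a => 1 - P (E a)ᶜ) l (𝓝 1) := by
    simpa using ENNReal.Tendsto.sub tendsto_const_nhds h (.inl ENNReal.one_ne_top)
  refine tendsto_of_tendsto_of_tendsto_of_le_of_le hlim tendsto_const_nhds (fun a => ?_)
    fun a => prob_le_one
  rw [tsub_le_iff_right]
  calc (1 : ℝ≥0∞) = P (E a ∪ (E a)ᶜ) := by rw [Set.union_compl_self, measure_univ]
    _ ≤ P (E a) + P (E a)ᶜ := measure_union_le _ _

end Coupling

section BitVectors

variable {ι : Type*}

/-- The event that all bits at the locations in `A` are `0`. These events form a `π`-system that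
generates the product `σ`-algebra, so they determine the law of a random bit vector. -/
def clearOn (A : Finset ι) : Set (ι → Bool) := {s | ∀ c ∈ A, s c = false}

theorem clearOn_eq_pi (A : Finset ι) : clearOn A = Set.pi (A : Set ι) fun _ => {false} := rfl

theorem clearOn_singleton (c : ι) : clearOn {c} = {s | s c = false} := by
  simp [clearOn]

theorem measurableSet_clearOn (A : Finset ι) : MeasurableSet (clearOn A) :=
  MeasurableSet.pi A.countable_toSet fun _ _ => measurableSet_singleton _

theorem isPiSystem_range_clearOn : IsPiSystem (Set.range (clearOn (ι := ι))) := by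
  classical
  rintro _ ⟨A, rfl⟩ _ ⟨A', rfl⟩ _
  refine ⟨A ∪ A', ?_⟩
  simp_rw [clearOn_eq_pi, Finset.coe_union, Set.union_pi]

theorem generateFrom_range_clearOn :
    MeasurableSpace.generateFrom (Set.range (clearOn (ι := ι))) = MeasurableSpace.pi := by
  refine le_antisymm (MeasurableSpace.generateFrom_le ?_) (iSup_le fun c => ?_)
  · rintro _ ⟨A, rfl⟩
    exact measurableSet_clearOn A
  · rw [← measurable_iff_comap_le]
    refine @measurable_to_bool _ (_) _ ?_
    have hclear : (fun s : ι → Bool => s c) ⁻¹' {true} = (clearOn {c})ᶜ := by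
      ext s
      simp [clearOn]
    rw [hclear]
    exact MeasurableSet.compl (MeasurableSpace.measurableSet_generateFrom ⟨{c}, rfl⟩)

theorem ext_of_clearOn {μ ν : Measure (ι → Bool)} [IsProbabilityMeasure μ]
    [IsProbabilityMeasure ν] (h : ∀ A, μ (clearOn A) = ν (clearOn A)) : μ = ν :=
  ext_of_generate_finite _ generateFrom_range_clearOn.symm isPiSystem_range_clearOn
    (Set.forall_mem_range.2 h) (by simp)

theorem iSup_apply_eq_false_iff {κ : Sort*} (h : κ → ι → Bool) (c : ι) :
    (⨆ x, h x) c = false ↔ ∀ x, h x c = false := by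
  rw [iSup_apply]
  exact iSup_eq_bot

theorem measurable_iSup_bits {n : ℕ} : Measurable fun h : Fin n → ι → Bool => ⨆ x, h x := by
  refine measurable_pi_lambda _ fun c => ?_
  simp_rw [iSup_apply]
  exact (measurable_of_countable fun g : Fin n → Bool => ⨆ x, g x).comp
    (measurable_pi_lambda _ fun x => (measurable_pi_apply c).comp (measurable_pi_apply x))

/-- The law of the bitwise disjunction of `n` independent random bit vectors with law `μ`. -/
noncomputable def orPow (μ : Measure (ι → Bool)) (n : ℕ) : Measure (ι → Bool) :=
  (Measure.pi fun _ : Fin n => μ).map fun h => ⨆ x, h x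

instance isProbabilityMeasure_orPow (μ : Measure (ι → Bool)) [IsProbabilityMeasure μ] (n : ℕ) :
    IsProbabilityMeasure (orPow μ n) :=
  Measure.isProbabilityMeasure_map measurable_iSup_bits.aemeasurable

theorem orPow_clearOn (μ : Measure (ι → Bool)) [SigmaFinite μ] (n : ℕ) (A : Finset ι) :
    orPow μ n (clearOn A) = μ (clearOn A) ^ n := by
  have hpre : (fun h : Fin n → ι → Bool => ⨆ x, h x) ⁻¹' clearOn A =
      Set.univ.pi fun _ => clearOn A := by
    ext h
    simp only [clearOn, Set.mem_preimage, Set.mem_ofPred_eq, iSup_apply_eq_false_iff,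
      Set.mem_univ_pi]
    exact ⟨fun H x c hc => H c hc x, fun H c hc x => H x c hc⟩
  rw [orPow, Measure.map_apply measurable_iSup_bits (measurableSet_clearOn A), hpre,
    Measure.pi_pi, Finset.prod_const, Finset.card_fin]

theorem orPow_apply_eq_false (μ : Measure (ι → Bool)) [SigmaFinite μ] (n : ℕ) (c : ι) :
    orPow μ n {s | s c = false} = μ {s | s c = false} ^ n := by
  rw [← clearOn_singleton, orPow_clearOn]

theorem map_domRestrict_orPow (μ : Measure (ι → Bool)) [IsProbabilityMeasure μ] (n : ℕ)
    (W : Set ι) :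
    (orPow μ n).map W.domRestrict = orPow (μ.map W.domRestrict) n := by
  have hW : Measurable (W.domRestrict : (ι → Bool) → W → Bool) := W.measurable_restrict
  have := Measure.isProbabilityMeasure_map (μ := μ) hW.aemeasurable
  have hWn : Measurable fun (h : Fin n → ι → Bool) x => W.domRestrict (h x) :=
    measurable_pi_lambda _ fun x => hW.comp (measurable_pi_apply x)
  rw [orPow, orPow, ← Measure.pi_map_pi fun _ => hW.aemeasurable,
    Measure.map_map hW measurable_iSup_bits, Measure.map_map measurable_iSup_bits hWn]
  congr 1
  ext h c
  simp

theorem tvDist_orPow_le (μ ν : Measure (ι → Bool)) [IsProbabilityMeasure μ]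
    [IsProbabilityMeasure ν] (n : ℕ) : tvDist (orPow μ n) (orPow ν n) ≤ n * tvDist μ ν := by
  refine (tvDist_map_le _ _ measurable_iSup_bits).trans ((tvDist_pi_le _ _).trans_eq ?_)
  rw [Finset.sum_const, Finset.card_fin, nsmul_eq_mul]

/-- The law of independent bits, where the bit at `c` vanishes with probability `β c`. -/
noncomputable def bitsLaw (β : ι → I) : Measure (ι → Bool) :=
  Measure.infinitePi fun c => bernoulliMeasure false true (β c)

instance isProbabilityMeasure_bitsLaw (β : ι → I) : IsProbabilityMeasure (bitsLaw β) := by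
  unfold bitsLaw
  infer_instance

theorem bernoulliMeasure_false_true_singleton_false (b : I) :
    bernoulliMeasure false true b {false} = ENNReal.ofReal b := by
  rw [← ofReal_measureReal, bernoulliMeasure_real_apply _ (measurableSet_singleton _)]
  simp

theorem bitsLaw_clearOn (β : ι → I) (A : Finset ι) :
    bitsLaw β (clearOn A) = ∏ c ∈ A, ENNReal.ofReal (β c) := by
  rw [clearOn_eq_pi, bitsLaw, Measure.infinitePi_pi _ fun _ _ => measurableSet_singleton _]
  simp_rw [bernoulliMeasure_false_true_singleton_false]

theorem bitsLaw_apply_eq_false (β : ι → I) (c : ι) :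
    bitsLaw β {s | s c = false} = ENNReal.ofReal (β c) := by
  rw [← clearOn_singleton, bitsLaw_clearOn, Finset.prod_singleton]

theorem bitsLaw_apply_eq_true (β : ι → I) (c : ι) :
    bitsLaw β {s | s c = true} = ENNReal.ofReal (1 - β c) := by
  have hcompl : {s : ι → Bool | s c = true} = {s | s c = false}ᶜ := by
    ext s
    simp
  rw [hcompl, prob_compl_eq_one_sub (clearOn_singleton c ▸ measurableSet_clearOn {c}),
    bitsLaw_apply_eq_false, ENNReal.ofReal_sub _ (β c).2.1, ENNReal.ofReal_one]

theorem bitsLaw_apply_eq_true_and (β : ι → I) {c c' : ι} (hc : c ≠ c') :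
    bitsLaw β {s | s c = true ∧ s c' = true} =
      bitsLaw β {s | s c = true} * bitsLaw β {s | s c' = true} := by
  classical
  have hpi : {s : ι → Bool | s c = true ∧ s c' = true} =
      Set.pi (({c, c'} : Finset ι) : Set ι) fun _ => {true} := by
    ext s
    simp
  have hpi' (d : ι) : {s : ι → Bool | s d = true} =
      Set.pi (({d} : Finset ι) : Set ι) fun _ => {true} := by
    ext s
    simp
  rw [hpi, hpi', hpi']
  unfold bitsLaw
  simp_rw [Measure.infinitePi_pi _ fun _ _ => measurableSet_singleton _]
  rw [Finset.prod_pair hc, Finset.prod_singleton, Finset.prod_singleton]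

theorem map_domRestrict_bitsLaw (β : ι → I) (W : Set ι) :
    (bitsLaw β).map W.domRestrict = bitsLaw fun c : W => β c :=
  Measure.infinitePi_map_restrict' _

theorem tvDist_le_tvDist_map_domRestrict_add [Countable ι] (μ ν : Measure (ι → Bool))
    (W : Set ι) :
    tvDist μ ν ≤ tvDist (μ.map W.domRestrict) (ν.map W.domRestrict) +
      ∑' c : ↥Wᶜ, μ {s | s c = false} + ∑' c : ↥Wᶜ, ν {s | s c = false} := by
  classical
  let fill (t : W → Bool) : ι → Bool := fun c => if hc : c ∈ W then t ⟨c, hc⟩ else true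
  have hfill : Measurable fill := by
    refine measurable_pi_lambda _ fun c => ?_
    by_cases hc : c ∈ W
    · simpa only [fill, dif_pos hc] using measurable_pi_apply (⟨c, hc⟩ : W)
    · simpa only [fill, dif_neg hc] using measurable_const
  have hne : {s | fill (W.domRestrict s) ≠ s} ⊆ ⋃ c : ↥Wᶜ, {s | s c = false} := by
    intro s hs
    obtain ⟨c, hc⟩ := Function.ne_iff.1 hs
    by_cases hcW : c ∈ W
    · simp [fill, hcW] at hc
    · exact Set.mem_iUnion.2 ⟨⟨c, hcW⟩, by simpa [fill, hcW] using hc.symm⟩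
  have hbad (ξ : Measure (ι → Bool)) :
      ξ {s | fill (W.domRestrict s) ≠ s} ≤ ∑' c : ↥Wᶜ, ξ {s | s c = false} :=
    (measure_mono hne).trans (measure_iUnion_le _)
  refine (tvDist_le_tvDist_map_add μ ν W.measurable_restrict hfill).trans ?_
  gcongr
  · exact hbad μ
  · exact hbad ν

theorem orPow_bitsLaw (β : ι → I) (n : ℕ) : orPow (bitsLaw β) n = bitsLaw fun c => β c ^ n := by
  refine ext_of_clearOn fun A => ?_
  rw [orPow_clearOn, bitsLaw_clearOn, bitsLaw_clearOn, ← Finset.prod_pow]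
  simp_rw [← ENNReal.ofReal_pow (β _).2.1]
  rfl

theorem one_sub_tsum_le_measure_singleton_bot [Countable ι] (ν : Measure (ι → Bool))
    [IsProbabilityMeasure ν] : 1 - ∑' c, ν {s | s c = true} ≤ ν {⊥} := by
  have hcover : (Set.univ : Set (ι → Bool)) ⊆ {⊥} ∪ ⋃ c, {s | s c = true} := by
    intro s _
    by_cases h : s = ⊥
    · exact .inl h
    · obtain ⟨c, hc⟩ := Function.ne_iff.1 h
      exact .inr (Set.mem_iUnion.2 ⟨c, Bool.eq_true_of_not_eq_false hc⟩)
  rw [tsub_le_iff_right]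
  calc 1 = ν Set.univ := measure_univ.symm
    _ ≤ ν {⊥} + ∑' c, ν {s | s c = true} :=
        (measure_mono hcover).trans ((measure_union_le _ _).trans
          (add_le_add le_rfl (measure_iUnion_le _)))

section SingleBit

variable [DecidableEq ι]

/-- The bit vector whose only bit equal to `1` is the one at `c`. -/
def singleBit (c : ι) : ι → Bool := fun c' => decide (c = c')

theorem singleBit_preimage_clearOn (A : Finset ι) :
    singleBit ⁻¹' clearOn A = (A : Set ι)ᶜ := by
  ext c
  simp only [singleBit, clearOn, Set.mem_preimage, Set.mem_ofPred_eq, decide_eq_false_iff_not]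
  exact ⟨fun h hc => h c hc rfl, fun h c' hc' hcc' => h (hcc' ▸ hc')⟩

theorem domRestrict_singleBit_val {W : Set ι} (c : W) :
    W.domRestrict (singleBit c.1) = singleBit c := by
  ext c'
  simp [singleBit, Subtype.ext_iff]

theorem domRestrict_singleBit_of_notMem {W : Set ι} {c : ι} (hc : c ∉ W) :
    W.domRestrict (singleBit c) = ⊥ := by
  ext c'
  have : c ≠ c' := fun h => hc (h ▸ c'.2)
  simp [singleBit, this]

theorem bitsLaw_mul_one_sub_tsum_le [Countable ι] (β : ι → I) (c : ι) :
    bitsLaw β {s | s c = true} * (1 - ∑' c' : ({c}ᶜ : Set ι), bitsLaw β {s | s c' = true}) ≤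
      bitsLaw β {singleBit c} := by
  have hcover : {s : ι → Bool | s c = true} ⊆
      {singleBit c} ∪ ⋃ c' : ({c}ᶜ : Set ι), {s | s c = true ∧ s c' = true} := by
    intro s hs
    by_cases h : ∃ c', c' ≠ c ∧ s c' = true
    · obtain ⟨c', hc', hsc'⟩ := h
      exact .inr (Set.mem_iUnion.2 ⟨⟨c', hc'⟩, hs, hsc'⟩)
    · push Not at h
      refine .inl (funext fun c' => ?_)
      by_cases hc' : c' = c
      · simpa [singleBit, hc'] using hs
      · simpa [singleBit, Ne.symm hc'] using h c' hc'
  rw [ENNReal.mul_sub fun _ _ => measure_ne_top _ _, mul_one, tsub_le_iff_right,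
    ← ENNReal.tsum_mul_left]
  refine (measure_mono hcover).trans ((measure_union_le _ _).trans
    (add_le_add le_rfl ((measure_iUnion_le _).trans_eq ?_)))
  exact tsum_congr fun c' => bitsLaw_apply_eq_true_and β (Ne.symm c'.2)

end SingleBit

end BitVectors

theorem one_sub_add_le_one_sub_mul_one_sub (a b : ℝ≥0∞) : 1 - (a + b) ≤ (1 - a) * (1 - b) := by
  rw [tsub_le_iff_right]
  calc (1 : ℝ≥0∞) ≤ (1 - a) * 1 + a := by rw [mul_one]; exact le_tsub_add
    _ ≤ (1 - a) * (1 - b + b) + a := by gcongr; exact le_tsub_add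
    _ ≤ (1 - a) * (1 - b) + 1 * b + a := by
        rw [mul_add]
        gcongr
        exact tsub_le_self
    _ = (1 - a) * (1 - b) + (a + b) := by ring

theorem mul_one_sub_le_one_sub_of_le_exp_neg {ρ b : ℝ} (hρ : |ρ| ≤ 1) (hb : b ≤ Real.exp (-ρ)) :
    ρ * (1 - ρ) ≤ 1 - b := by
  have h := le_of_abs_le (Real.abs_exp_sub_one_sub_id_le ((abs_neg ρ).trans_le hρ))
  linarith

section Items

variable {ι : Type*} [MeasurableSpace ι]

theorem bitsLaw_apply_eq_true_le (q : Measure ι) [IsFiniteMeasure q] {W : Set ι} {β : W → I}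
    (hβ : ∀ c : W, 1 - q.real {c.1} ≤ β c) (c : W) :
    bitsLaw β {s | s c = true} ≤ q {c.1} := by
  rw [bitsLaw_apply_eq_true, ← ofReal_measureReal]
  exact ENNReal.ofReal_le_ofReal (by linarith [hβ c])

theorem le_bitsLaw_apply_eq_true (q : Measure ι) [IsProbabilityMeasure q] {W : Set ι}
    {β : W → I} (hβ : ∀ c : W, β c ≤ Real.exp (-q.real {c.1})) (c : W) :
    q {c.1} * (1 - q {c.1}) ≤ bitsLaw β {s | s c = true} := by
  rw [bitsLaw_apply_eq_true, ← ofReal_measureReal (μ := q), ← ENNReal.ofReal_one,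
    ← ENNReal.ofReal_sub _ measureReal_nonneg, ← ENNReal.ofReal_mul measureReal_nonneg]
  refine ENNReal.ofReal_le_ofReal (mul_one_sub_le_one_sub_of_le_exp_neg ?_ (hβ c))
  exact (abs_of_nonneg measureReal_nonneg).trans_le measureReal_le_one

variable [Countable ι] [MeasurableSingletonClass ι]

theorem tsum_measure_singleton_val (q : Measure ι) (W : Set ι) : ∑' c : W, q {c.1} = q W := by
  simpa using tsum_measure_preimage_singleton (μ := q) (f := id) W.to_countable
    fun c _ => measurableSet_singleton c

theorem measure_compl_le_bitsLaw_singleton_bot (q : Measure ι) [IsProbabilityMeasure q]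
    {W : Set ι} {β : W → I} (hβ : ∀ c : W, 1 - q.real {c.1} ≤ β c) :
    q Wᶜ ≤ bitsLaw β {⊥} := by
  refine le_trans ?_ (one_sub_tsum_le_measure_singleton_bot _)
  rw [prob_compl_eq_one_sub W.to_countable.measurableSet, ← tsum_measure_singleton_val q W]
  exact tsub_le_tsub_left (ENNReal.tsum_le_tsum (bitsLaw_apply_eq_true_le q hβ)) 1

variable [DecidableEq ι]

theorem measure_compl_mul_le_bitsLaw_singleBit (q : Measure ι) [IsProbabilityMeasure q]
    {W : Set ι} {β : W → I} (hβ : ∀ c : W, 1 - q.real {c.1} ≤ β c)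
    (hβ' : ∀ c : W, β c ≤ Real.exp (-q.real {c.1})) (c : W) :
    q Wᶜ * q {c.1} ≤ bitsLaw β {singleBit c} := by
  have hsplit : q W = q {c.1} + ∑' c' : ({c}ᶜ : Set W), q {c'.1.1} := by
    rw [← tsum_measure_singleton_val q W, ← tsum_singleton c fun c' : W => q {c'.1}]
    exact (ENNReal.summable.tsum_add_tsum_compl ENNReal.summable).symm
  calc q Wᶜ * q {c.1}
      ≤ (1 - q {c.1}) * (1 - ∑' c' : ({c}ᶜ : Set W), q {c'.1.1}) * q {c.1} := by
        rw [prob_compl_eq_one_sub W.to_countable.measurableSet, hsplit]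
        gcongr
        exact one_sub_add_le_one_sub_mul_one_sub _ _
    _ = q {c.1} * (1 - q {c.1}) * (1 - ∑' c' : ({c}ᶜ : Set W), q {c'.1.1}) := by ring
    _ ≤ bitsLaw β {s | s c = true} *
          (1 - ∑' c' : ({c}ᶜ : Set W), bitsLaw β {s | s c' = true}) := by
        gcongr
        · exact le_bitsLaw_apply_eq_true q hβ' c
        · exact bitsLaw_apply_eq_true_le q hβ _
    _ ≤ bitsLaw β {singleBit c} := bitsLaw_mul_one_sub_tsum_le β c

theorem tvDist_map_domRestrict_singleBit_bitsLaw_le (q : Measure ι) [IsProbabilityMeasure q]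
    {W : Set ι} {β : W → I} (hβ : ∀ c : W, 1 - q.real {c.1} ≤ β c)
    (hβ' : ∀ c : W, β c ≤ Real.exp (-q.real {c.1})) :
    tvDist (q.map fun c => W.domRestrict (singleBit c)) (bitsLaw β) ≤ q W ^ 2 := by
  set f : ι → W → Bool := fun c => W.domRestrict (singleBit c)
  have hf : Measurable f := measurable_of_countable f
  have hW : MeasurableSet W := W.to_countable.measurableSet
  have hmass : (q W • (q.restrict W).map f) Set.univ = q W ^ 2 := by
    rw [Measure.smul_apply, Measure.map_apply hf MeasurableSet.univ, Set.preimage_univ,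
      Measure.restrict_apply_univ, smul_eq_mul, sq]
  rw [← hmass]
  refine tvDist_map_le_of_singleton_le hf fun c => ?_
  rw [Measure.map_apply hf (measurableSet_singleton _), Measure.smul_apply,
    Measure.map_apply hf (measurableSet_singleton _), Measure.restrict_apply' hW, smul_eq_mul]
  by_cases hc : c ∈ W
  · have hpre : f ⁻¹' {f c} = {c} := by
      refine Set.Subset.antisymm (fun d hd => ?_) (Set.singleton_subset_iff.2 rfl)
      simpa [f, singleBit] using congrFun hd ⟨c, hc⟩
    rw [hpre, Set.inter_eq_left.2 (Set.singleton_subset_iff.2 hc)]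
    calc q {c} = q Wᶜ * q {c} + q W * q {c} := by
          rw [← add_mul, add_comm, measure_add_measure_compl hW, measure_univ, one_mul]
      _ ≤ bitsLaw β {f c} + q W * q {c} := by
          gcongr
          simp only [f, domRestrict_singleBit_val ⟨c, hc⟩]
          exact measure_compl_mul_le_bitsLaw_singleBit q hβ hβ' ⟨c, hc⟩
  · have hpre : f ⁻¹' {f c} ⊆ Wᶜ := by
      intro d hd hdW
      have := congrFun (hd.trans (domRestrict_singleBit_of_notMem hc)) ⟨d, hdW⟩
      simp [f, singleBit] at this
    refine le_add_right ((measure_mono hpre).trans ?_)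
    simp only [f, domRestrict_singleBit_of_notMem hc]
    exact measure_compl_le_bitsLaw_singleton_bot q hβ

theorem map_singleBit_clearOn (q : Measure ι) (A : Finset ι) :
    q.map singleBit (clearOn A) = q (A : Set ι)ᶜ := by
  rw [Measure.map_apply (measurable_of_countable _) (measurableSet_clearOn A),
    singleBit_preimage_clearOn]

theorem orPow_map_singleBit_clearOn (q : Measure ι) [IsProbabilityMeasure q] (n : ℕ)
    (A : Finset ι) :
    orPow (q.map singleBit) n (clearOn A) = ENNReal.ofReal (1 - q.real A) ^ n := by
  have := Measure.isProbabilityMeasure_map (μ := q)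
    (measurable_of_countable (singleBit (ι := ι))).aemeasurable
  rw [orPow_clearOn, map_singleBit_clearOn, ← ofReal_measureReal,
    probReal_compl_eq_one_sub A.measurableSet]

theorem tvDist_orPow_map_singleBit_le (q : Measure ι) [IsProbabilityMeasure q] {β : ι → I}
    (hβ : ∀ c, 1 - q.real {c} ≤ β c) (hβ' : ∀ c, β c ≤ Real.exp (-q.real {c})) (n : ℕ)
    (W : Set ι) :
    tvDist (orPow (q.map singleBit) n) (orPow (bitsLaw β) n) ≤
      n * q W ^ 2 + 2 * ∑' c : ↥Wᶜ, ENNReal.ofReal (Real.exp (-(n * q.real {c.1}))) := by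
  have hbit : Measurable (singleBit (ι := ι)) := measurable_of_countable _
  have := Measure.isProbabilityMeasure_map (μ := q) hbit.aemeasurable
  have hW : Measurable (W.domRestrict : (ι → Bool) → W → Bool) := W.measurable_restrict
  have := Measure.isProbabilityMeasure_map (μ := q) (hW.comp hbit).aemeasurable
  have hpow {b : ℝ} {c : ι} (hb : b ≤ Real.exp (-q.real {c})) :
      ENNReal.ofReal b ^ n ≤ ENNReal.ofReal (Real.exp (-(n * q.real {c}))) := by
    rw [← mul_neg, Real.exp_nat_mul, ENNReal.ofReal_pow (Real.exp_pos _).le]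
    gcongr
  have hq (c : ι) : orPow (q.map singleBit) n {s | s c = false} ≤
      ENNReal.ofReal (Real.exp (-(n * q.real {c}))) := by
    rw [← clearOn_singleton, orPow_map_singleBit_clearOn, Finset.coe_singleton]
    exact hpow (Real.one_sub_le_exp_neg _)
  have hβq (c : ι) : orPow (bitsLaw β) n {s | s c = false} ≤
      ENNReal.ofReal (Real.exp (-(n * q.real {c}))) := by
    rw [orPow_apply_eq_false, bitsLaw_apply_eq_false]
    exact hpow (hβ' c)
  refine (tvDist_le_tvDist_map_domRestrict_add _ _ W).trans ?_
  rw [map_domRestrict_orPow, map_domRestrict_orPow, map_domRestrict_bitsLaw, two_mul, ← add_assoc,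
    Measure.map_map hW hbit]
  gcongr
  · refine (tvDist_orPow_le _ _ n).trans ?_
    gcongr
    exact tvDist_map_domRestrict_singleBit_bitsLaw_le q (fun c => hβ c) fun c => hβ' c
  · exact hq _
  · exact hβq _

theorem lintegral_pow_poissonMeasure (r : NNReal) {x : ℝ} (hx : 0 ≤ x) :
    ∫⁻ m, ENNReal.ofReal x ^ m ∂poissonMeasure r = ENNReal.ofReal (Real.exp (-(r * (1 - x)))) := by
  have hsum : HasSum (fun m : ℕ => Real.exp (-r) * r ^ m / m.factorial * x ^ m)
      (Real.exp (-(r * (1 - x)))) := by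
    have h := (NormedSpace.expSeries_div_hasSum_exp ((r : ℝ) * x)).mul_left (Real.exp (-r))
    rw [← Real.exp_eq_exp_ℝ, ← Real.exp_add] at h
    have hexp : -(r * (1 - x)) = -r + r * x := by ring
    rw [hexp]
    refine h.congr_fun fun m => ?_
    rw [mul_pow]
    ring
  have hnonneg (m : ℕ) : 0 ≤ Real.exp (-r) * r ^ m / m.factorial * x ^ m := by positivity
  rw [poissonMeasure, lintegral_sum_measure, ← hsum.tsum_eq,
    ENNReal.ofReal_tsum_of_nonneg hnonneg hsum.summable]
  refine tsum_congr fun m => ?_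
  rw [lintegral_smul_measure, lintegral_dirac, smul_eq_mul, ENNReal.ofReal_mul (by positivity),
    ENNReal.ofReal_pow hx]

theorem bind_poissonMeasure_orPow_map_singleBit (r : NNReal) (q : Measure ι)
    [IsProbabilityMeasure q] {β : ι → I} (hβ : ∀ c, (β c : ℝ) = Real.exp (-(r * q.real {c}))) :
    (poissonMeasure r).bind (orPow (q.map singleBit)) = bitsLaw β := by
  have := Measure.isProbabilityMeasure_map (μ := q)
    (measurable_of_countable (singleBit (ι := ι))).aemeasurable
  have hm : AEMeasurable (orPow (q.map singleBit)) (poissonMeasure r) :=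
    (measurable_of_countable _).aemeasurable
  have := isProbabilityMeasure_bind hm (Eventually.of_forall fun _ => inferInstance)
  refine ext_of_clearOn fun A => ?_
  rw [Measure.bind_apply (measurableSet_clearOn A) hm, bitsLaw_clearOn]
  simp_rw [orPow_map_singleBit_clearOn, hβ]
  rw [lintegral_pow_poissonMeasure r (sub_nonneg.2 measureReal_le_one), sub_sub_cancel,
    ← ENNReal.ofReal_prod_of_nonneg fun _ _ => (Real.exp_pos _).le, ← Real.exp_sum,
    Finset.sum_neg_distrib, ← Finset.mul_sum, sum_measureReal_singleton]

end Items

theorem geometricMeasure_real_Ici {p : I} (hp : p ≠ 0) (j : ℕ) :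
    (geometricMeasure p).real (Set.Ici j) = (1 - p) ^ j := by
  have hcompl : Set.Ici j = ((Finset.range j : Finset ℕ) : Set ℕ)ᶜ := by
    ext k
    simp
  rw [hcompl, probReal_compl_eq_one_sub (Finset.measurableSet _), ← sum_measureReal_singleton]
  simp_rw [geometricMeasure_real_singleton hp]
  have hgeom := geom_sum_mul_neg (1 - p : ℝ) j
  rw [sub_sub_cancel] at hgeom
  rw [← Finset.sum_mul, hgeom, sub_sub_cancel]

theorem sum_exp_neg_mul_two_pow_le {x : ℝ} (hx : 1 ≤ x) (j : ℕ) :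
    ∑ i ∈ Finset.range j, Real.exp (-(x * 2 ^ i)) ≤ 2 * Real.exp (-x) := by
  have hexp : Real.exp (-1) ≤ 1 / 2 := by linarith [Real.exp_neg_one_lt_d9]
  have hterm (i : ℕ) : -(x * 2 ^ i) ≤ -x + i * (-1) := by
    have hpow : (1 : ℝ) + i ≤ 2 ^ i := by
      simpa [one_add_one_eq_two] using one_add_mul_le_pow (a := (1 : ℝ)) (by norm_num) i
    nlinarith [(Nat.cast_nonneg i : (0 : ℝ) ≤ i)]
  calc ∑ i ∈ Finset.range j, Real.exp (-(x * 2 ^ i))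
      ≤ ∑ i ∈ Finset.range j, Real.exp (-x) * (1 / 2) ^ i := by
        refine Finset.sum_le_sum fun i _ => (Real.exp_le_exp.2 (hterm i)).trans ?_
        rw [Real.exp_add, Real.exp_nat_mul]
        gcongr
    _ ≤ Real.exp (-x) * 2 := by
        rw [← Finset.mul_sum]
        gcongr
        exact sum_geometric_two_le j
    _ = 2 * Real.exp (-x) := mul_comm _ _

theorem exists_mul_inv_two_pow_ge_and_le {x y r : ℝ} (hy : 1 ≤ y) (hr : 1 ≤ r)
    (h : y * r ^ 2 ≤ √x) :
    ∃ j : ℕ, y * r ≤ x * (2 : ℝ)⁻¹ ^ j ∧ x * ((2 : ℝ)⁻¹ ^ j) ^ 2 ≤ 4 / r ^ 2 := by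
  have hyr : y * r ≤ y * r ^ 2 := by gcongr; exact le_self_pow₀ hr two_ne_zero
  have hx1 : 1 ≤ √x := (one_le_mul_of_one_le_of_one_le hy (one_le_pow₀ hr)).trans h
  have hx0 : 0 < x := Real.sqrt_pos.1 (by linarith)
  have hsq : √x ^ 2 = x := Real.sq_sqrt hx0.le
  have hyrx : y * r ≤ x := by nlinarith
  have hyr0 : 0 < y * r := by positivity
  obtain ⟨j, hj, hj'⟩ := exists_nat_pow_near ((one_le_div hyr0).2 hyrx) (one_lt_two (α := ℝ))
  rw [le_div_iff₀ hyr0] at hj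
  rw [div_lt_iff₀ hyr0, pow_succ] at hj'
  have h2j : (0 : ℝ) < 2 ^ j := by positivity
  refine ⟨j, ?_, ?_⟩
  · rw [inv_pow, ← div_eq_mul_inv, le_div_iff₀ h2j]
    linarith
  · rw [inv_pow, inv_pow, ← div_eq_mul_inv, div_le_div_iff₀ (by positivity) (by positivity)]
    refine le_of_mul_le_mul_right ?_ hx0
    calc x * r ^ 2 * x = x ^ 2 * r ^ 2 := by ring
      _ ≤ (2 ^ j * 2 * (y * r)) ^ 2 * r ^ 2 := by gcongr
      _ = 4 * (2 ^ j) ^ 2 * (y * r ^ 2) ^ 2 := by ring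
      _ ≤ 4 * (2 ^ j) ^ 2 * √x ^ 2 := by gcongr
      _ = 4 * (2 ^ j) ^ 2 * x := by rw [hsq]

theorem mul_exp_neg_le_two_div_sq {b r x : ℝ} (hb : 0 < b) (hr : 0 < r)
    (hx : Real.log b + r ≤ x) : b * Real.exp (-x) ≤ 2 / r ^ 2 := by
  calc b * Real.exp (-x) ≤ b * Real.exp (-(Real.log b + r)) := by gcongr
    _ = (Real.exp r)⁻¹ := by
        rw [neg_add, Real.exp_add, Real.exp_neg, Real.exp_neg, Real.exp_log hb,
          mul_inv_cancel_left₀ hb.ne']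
    _ ≤ (r ^ 2 / 2)⁻¹ := by
        gcongr
        linarith [Real.quadratic_le_exp_of_nonneg hr.le]
    _ = 2 / r ^ 2 := inv_div _ _

theorem sum_exp_neg_mul_cellProb_le {B : ℕ} (n j : ℕ) (hx : 1 ≤ n * (2 : ℝ)⁻¹ ^ j / B) :
    ∑ c ∈ (Finset.univ : Finset (Fin B)) ×ˢ Finset.range j, Real.exp (-(n * cellProb c)) ≤
      2 * B * Real.exp (-(n * (2 : ℝ)⁻¹ ^ j / B)) := by
  have hlevel (i : ℕ) (hi : i < j) : (n : ℝ) * ((2 : ℝ)⁻¹ ^ (j - 1 - i + 1) / B) =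
      n * (2 : ℝ)⁻¹ ^ j / B * 2 ^ i := by
    obtain ⟨k, rfl⟩ : ∃ k, j = k + 1 + i := ⟨j - 1 - i, by omega⟩
    have hk : k + 1 + i - 1 - i = k := by omega
    rw [hk, pow_add _ (k + 1) i, inv_pow 2 i]
    field_simp
  calc ∑ c ∈ (Finset.univ : Finset (Fin B)) ×ˢ Finset.range j, Real.exp (-(n * cellProb c))
      = B * ∑ k ∈ Finset.range j, Real.exp (-(n * ((2 : ℝ)⁻¹ ^ (k + 1) / B))) := by
        simp only [Finset.sum_product, cellProb, Finset.sum_const, Finset.card_univ,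
          Fintype.card_fin, nsmul_eq_mul]
    _ = B * ∑ i ∈ Finset.range j, Real.exp (-(n * (2 : ℝ)⁻¹ ^ j / B * 2 ^ i)) := by
        rw [← Finset.sum_range_reflect]
        refine congrArg _ (Finset.sum_congr rfl fun i hi => ?_)
        rw [hlevel i (Finset.mem_range.1 hi)]
    _ ≤ B * (2 * Real.exp (-(n * (2 : ℝ)⁻¹ ^ j / B))) := by
        gcongr
        exact sum_exp_neg_mul_two_pow_le hx j
    _ = 2 * B * Real.exp (-(n * (2 : ℝ)⁻¹ ^ j / B)) := by ring

theorem tsum_ofReal_exp_neg_mul_cellProb_le {B : ℕ} (n j : ℕ) (hx : 1 ≤ n * (2 : ℝ)⁻¹ ^ j / B) :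
    ∑' c : ↥{c : Cell B | j ≤ c.2}ᶜ, ENNReal.ofReal (Real.exp (-(n * cellProb c.1))) ≤
      ENNReal.ofReal (2 * B * Real.exp (-(n * (2 : ℝ)⁻¹ ^ j / B))) := by
  have hlow : {c : Cell B | j ≤ c.2}ᶜ = ↑((Finset.univ : Finset (Fin B)) ×ˢ Finset.range j) := by
    ext c
    simp
  rw [hlow, Finset.tsum_subtype' _ fun c : Cell B =>
      ENNReal.ofReal (Real.exp (-(n * cellProb c))),
    ← ENNReal.ofReal_sum_of_nonneg fun c _ => (Real.exp_pos _).le]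
  exact ENNReal.ofReal_le_ofReal (sum_exp_neg_mul_cellProb_le n j hx)

section Pcsa

variable {B : ℕ} [NeZero B]

theorem hashLaw_le_snd (j : ℕ) :
    hashLaw B {c | j ≤ c.2} = ENNReal.ofReal ((2 : ℝ)⁻¹ ^ j) := by
  have := isProbabilityMeasure_uniformOn (Set.finite_univ (α := Fin B)) Set.univ_nonempty
  have hprod : {c : Cell B | j ≤ c.2} = Set.univ ×ˢ Set.Ici j := by
    ext c
    simp
  rw [← ofReal_measureReal, hprod, hashLaw, measureReal_prod_prod, probReal_univ, one_mul,
    geometricMeasure_real_Ici (by simp [← unitInterval.coe_ne_zero])]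
  norm_num

theorem pcsaLaw_eq_orPow (n : ℕ) : pcsaLaw B n = orPow ((hashLaw B).map singleBit) n := by
  have hbit : Measurable (singleBit (ι := Cell B)) := measurable_of_countable _
  have := Measure.isProbabilityMeasure_map (μ := hashLaw B) hbit.aemeasurable
  rw [orPow, ← Measure.pi_map_pi fun _ => hbit.aemeasurable,
    Measure.map_map measurable_iSup_bits (measurable_of_countable _), pcsaLaw]
  congr 1
  ext h c
  have hfalse : pcsa h c = false ↔ (⨆ x, singleBit (h x)) c = false := by
    rw [iSup_apply_eq_false_iff]
    simp [pcsa, singleBit]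
  rw [Function.comp_apply, Bool.eq_iff_iff, ← Bool.not_eq_false, ← Bool.not_eq_false, hfalse]

theorem tvDist_pcsaLaw_bitsLaw_le_of_level {β : Cell B → I} (hβ : ∀ c, 1 - cellProb c ≤ β c)
    (hβ' : ∀ c, β c ≤ Real.exp (-cellProb c)) (n j : ℕ) (hx : 1 ≤ n * (2 : ℝ)⁻¹ ^ j / B) :
    tvDist (pcsaLaw B n) (bitsLaw fun c => β c ^ n) ≤
      ENNReal.ofReal (n * ((2 : ℝ)⁻¹ ^ j) ^ 2 +
        4 * (B * Real.exp (-(n * (2 : ℝ)⁻¹ ^ j / B)))) := by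
  simp_rw [← hashLaw_real_singleton] at hβ hβ'
  rw [pcsaLaw_eq_orPow, ← orPow_bitsLaw]
  refine (tvDist_orPow_map_singleBit_le (hashLaw B) hβ hβ' n {c | j ≤ c.2}).trans ?_
  simp_rw [hashLaw_real_singleton]
  rw [hashLaw_le_snd]
  calc (n : ℝ≥0∞) * ENNReal.ofReal ((2 : ℝ)⁻¹ ^ j) ^ 2 + 2 * ∑' c : ↥{c : Cell B | j ≤ c.2}ᶜ,
          ENNReal.ofReal (Real.exp (-(n * cellProb c.1)))
      ≤ n * ENNReal.ofReal ((2 : ℝ)⁻¹ ^ j) ^ 2 +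
          2 * ENNReal.ofReal (2 * B * Real.exp (-(n * (2 : ℝ)⁻¹ ^ j / B))) := by
        gcongr
        exact tsum_ofReal_exp_neg_mul_cellProb_le n j hx
    _ = _ := by
        rw [← ENNReal.ofReal_pow (by positivity), ← ENNReal.ofReal_natCast,
          ← ENNReal.ofReal_ofNat 2, ← ENNReal.ofReal_mul (by positivity),
          ← ENNReal.ofReal_mul (by positivity), ← ENNReal.ofReal_add (by positivity)
            (by positivity)]
        congr 1
        ring

theorem tvDist_pcsaLaw_bitsLaw_le {β : Cell B → I} (hβ : ∀ c, 1 - cellProb c ≤ β c)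
    (hβ' : ∀ c, β c ≤ Real.exp (-cellProb c)) {n : ℕ} (hn : B * (1 + Real.log B) ≤ √n) :
    tvDist (pcsaLaw B n) (bitsLaw fun c => β c ^ n) ≤
      ENNReal.ofReal (12 * (B * (1 + Real.log B) / √n)) := by
  have hB : (1 : ℝ) ≤ B := by exact_mod_cast NeZero.one_le
  have hlog : 0 ≤ Real.log B := Real.log_nonneg hB
  have hy : 1 ≤ B * (1 + Real.log B) := one_le_mul_of_one_le_of_one_le hB (by linarith)
  have hy0 : 0 < B * (1 + Real.log B) := by linarith
  set r := √(√n / (B * (1 + Real.log B)))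
  have hr : 1 ≤ r := Real.one_le_sqrt.2 ((one_le_div hy0).2 hn)
  have hr2 : r ^ 2 = √n / (B * (1 + Real.log B)) := Real.sq_sqrt (by positivity)
  obtain ⟨j, hjx, hj⟩ := exists_mul_inv_two_pow_ge_and_le hy hr
    (hr2 ▸ (mul_div_cancel₀ _ hy0.ne').le)
  have hx : (1 + Real.log B) * r ≤ n * (2 : ℝ)⁻¹ ^ j / B := by
    rw [le_div_iff₀ (by positivity)]
    linarith
  have hx1 : 1 ≤ n * (2 : ℝ)⁻¹ ^ j / B := by nlinarith
  have hexp : B * Real.exp (-(n * (2 : ℝ)⁻¹ ^ j / B)) ≤ 2 / r ^ 2 :=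
    mul_exp_neg_le_two_div_sq (by positivity) (by positivity) (by nlinarith)
  refine (tvDist_pcsaLaw_bitsLaw_le_of_level hβ hβ' n j hx1).trans (ENNReal.ofReal_le_ofReal ?_)
  calc n * ((2 : ℝ)⁻¹ ^ j) ^ 2 + 4 * (B * Real.exp (-(n * (2 : ℝ)⁻¹ ^ j / B)))
      ≤ 4 / r ^ 2 + 4 * (2 / r ^ 2) := by gcongr
    _ = 12 * (B * (1 + Real.log B) / √n) := by
        rw [hr2]
        field_simp
        norm_num

end Pcsa

theorem isLittleO_mul_one_add_log_of_isLittleO_mul_log {α : Type*} {l : Filter α} {b g : α → ℝ}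
    (hb : ∀ a, 1 ≤ b a) (hg : Tendsto g l atTop)
    (h : (fun a => b a * Real.log (b a)) =o[l] g) :
    (fun a => b a * (1 + Real.log (b a))) =o[l] g := by
  have hconst : (fun _ => (3 : ℝ)) =o[l] g :=
    isLittleO_const_left.2 (.inr (tendsto_norm_atTop_atTop.comp hg))
  have hb' : b =o[l] g := by
    refine (IsBigO.of_norm_le fun a => ?_).trans_isLittleO (h.add hconst)
    have hlog := Real.log_nonneg (hb a)
    rw [Real.norm_of_nonneg (zero_le_one.trans (hb a))]
    by_cases h3 : b a ≤ 3
    · nlinarith [hb a]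
    · have : 1 ≤ Real.log (b a) := by
        rw [Real.le_log_iff_exp_le (by linarith)]
        linarith [Real.exp_one_lt_three]
      nlinarith [hb a]
  refine (hb'.add h).congr_left fun a => ?_
  ring

theorem tendsto_tvDist_pcsaLaw_bitsLaw {B : ℕ → ℕ} [∀ n, NeZero (B n)]
    (hB : (fun n => (B n : ℝ) * Real.log (B n)) =o[atTop] (fun n : ℕ => Real.sqrt n))
    {β : ∀ n, Cell (B n) → I} (hβ : ∀ n c, 1 - cellProb c ≤ β n c)
    (hβ' : ∀ n c, β n c ≤ Real.exp (-cellProb c)) :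
    Tendsto (fun n => tvDist (pcsaLaw (B n) n) (bitsLaw fun c => β n c ^ n)) atTop (𝓝 0) := by
  have hsqrt : Tendsto (fun n : ℕ => √(n : ℝ)) atTop atTop :=
    Real.tendsto_sqrt_atTop.comp tendsto_natCast_atTop_atTop
  have hy : (fun n => (B n : ℝ) * (1 + Real.log (B n))) =o[atTop] fun n : ℕ => √(n : ℝ) :=
    isLittleO_mul_one_add_log_of_isLittleO_mul_log
      (fun n => by exact_mod_cast NeZero.one_le) hsqrt hB
  have hlim : Tendsto (fun n : ℕ => ENNReal.ofReal (12 * (B n * (1 + Real.log (B n)) / √n)))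
      atTop (𝓝 0) := by
    simpa using ENNReal.tendsto_ofReal (hy.tendsto_div_nhds_zero.const_mul 12)
  refine tendsto_of_tendsto_of_tendsto_of_le_of_le' tendsto_const_nhds hlim
    (.of_forall fun n => zero_le) ?_
  filter_upwards [hy.bound one_pos] with n hn
  refine tvDist_pcsaLaw_bitsLaw_le (hβ n) (hβ' n) ?_
  rw [one_mul, Real.norm_of_nonneg (Real.sqrt_nonneg _)] at hn
  exact (le_abs_self _).trans hn

theorem poissonPcsaLaw_eq_bitsLaw {B : ℕ} [NeZero B] (n : ℕ) {β : Cell B → I}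
    (hβ : ∀ c, (β c : ℝ) = Real.exp (-cellProb c)) :
    poissonPcsaLaw B n = bitsLaw fun c => β c ^ n := by
  have hpcsa : pcsaLaw B = orPow ((hashLaw B).map singleBit) := funext pcsaLaw_eq_orPow
  rw [poissonPcsaLaw, hpcsa]
  refine bind_poissonMeasure_orPow_map_singleBit _ _ fun c => ?_
  rw [Set.Icc.coe_pow, hβ, ← Real.exp_nat_mul, hashLaw_real_singleton, mul_neg]
  simp

theorem bernoulliMeasure_symm {X : Type*} [MeasurableSpace X] (x y : X) (p : I) :
    bernoulliMeasure x y (unitInterval.symm p) = bernoulliMeasure y x p := by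
  rw [bernoulliMeasure_def, bernoulliMeasure_def, unitInterval.symm_symm, add_comm]

theorem compositeLaw_eq_bitsLaw {B : ℕ} (n : ℕ) {β : Cell B → I}
    (hβ : ∀ c, (β c : ℝ) = 1 - cellProb c) :
    compositeLaw B n = bitsLaw fun c => β c ^ n := by
  rw [compositeLaw, bitsLaw]
  congr 1 with c : 1
  rw [map_eval_pcsaLaw, ← bernoulliMeasure_symm]
  congr 1
  ext
  simp [hβ]

theorem tendsto_tvDist_pcsaLaw_poissonPcsaLaw {B : ℕ → ℕ} [∀ n, NeZero (B n)]
    (hB : (fun n => (B n : ℝ) * Real.log (B n)) =o[atTop] (fun n : ℕ => Real.sqrt n)) :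
    Tendsto (fun n => tvDist (pcsaLaw (B n) n) (poissonPcsaLaw (B n) n)) atTop (𝓝 0) := by
  let β (n : ℕ) (c : Cell (B n)) : I := ⟨Real.exp (-cellProb c), (Real.exp_pos _).le,
    Real.exp_le_one_iff.2 (neg_nonpos.2 (cellProb_mem c).1)⟩
  have hβ (n : ℕ) : poissonPcsaLaw (B n) n = bitsLaw fun c => β n c ^ n :=
    poissonPcsaLaw_eq_bitsLaw n fun _ => rfl
  simp_rw [hβ]
  exact tendsto_tvDist_pcsaLaw_bitsLaw hB (fun _ _ => Real.one_sub_le_exp_neg _) fun _ _ => le_rfl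

theorem tendsto_tvDist_pcsaLaw_compositeLaw {B : ℕ → ℕ} [∀ n, NeZero (B n)]
    (hB : (fun n => (B n : ℝ) * Real.log (B n)) =o[atTop] (fun n : ℕ => Real.sqrt n)) :
    Tendsto (fun n => tvDist (pcsaLaw (B n) n) (compositeLaw (B n) n)) atTop (𝓝 0) := by
  let β (n : ℕ) (c : Cell (B n)) : I := unitInterval.symm ⟨cellProb c, cellProb_mem c⟩
  have hβ (n : ℕ) : compositeLaw (B n) n = bitsLaw fun c => β n c ^ n :=
    compositeLaw_eq_bitsLaw n fun _ => rfl
  simp_rw [hβ]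
  exact tendsto_tvDist_pcsaLaw_bitsLaw hB (fun _ _ => le_rfl) fun _ _ => Real.one_sub_le_exp_neg _

theorem mainTheorem4 (B : ℕ → ℕ) [∀ n, NeZero (B n)]
    (hB : (fun n => (B n : ℝ) * Real.log (B n)) =o[atTop] (fun n : ℕ => Real.sqrt n))
    {Ω : Type u} [MeasurableSpace Ω] (P : Measure Ω) [IsProbabilityMeasure P]
    (S : ∀ n, Ω → Sketch (B n)) (hS : ∀ n, HasLaw (S n) (pcsaLaw (B n) n) P) :
    ∃ (Ω' : Type u) (_ : MeasurableSpace Ω') (P' : Measure Ω') (_ : IsProbabilityMeasure P')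
      (π : Ω' → Ω) (Sbar Stilde : ∀ n, Ω' → Sketch (B n)),
      MeasurePreserving π P' P ∧
      (∀ n, HasLaw (Sbar n) (poissonPcsaLaw (B n) n) P') ∧
      (∀ n, HasLaw (Stilde n) (compositeLaw (B n) n) P') ∧
      Tendsto (fun n => P' {ω | S n (π ω) = Stilde n ω ∧ Stilde n ω = Sbar n ω})
        atTop (𝓝 1) := by
  obtain ⟨Ω', _, P', _, π, Sbar, Stilde, hπ, hSbar, hStilde, hne⟩ :=
    exists_enlarged_coupling_pair P (fun n => pcsaLaw (B n) n) (fun n => poissonPcsaLaw (B n) n)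
      (fun n => compositeLaw (B n) n) S hS
  have hlim := (tendsto_tvDist_pcsaLaw_poissonPcsaLaw hB).add
    (tendsto_tvDist_pcsaLaw_compositeLaw hB)
  rw [add_zero] at hlim
  exact ⟨Ω', _, P', ‹_›, π, Sbar, Stilde, hπ, hSbar, hStilde, tendsto_measure_one_of_compl <|
    tendsto_of_tendsto_of_tendsto_of_le_of_le tendsto_const_nhds hlim (fun _ => zero_le) hne⟩
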